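/- Let $X$ be a Polish space and let $\boldsymbol m$ be a nonnegative Radon measure on $X$, i.e. a (not necessarily finite) Borel measure that is finite on compact sets and inner regular with respect to compact sets. Let $\mathcal M^+(X)$ be the cone of finite positive Borel measures on $X$, and let $\tau_b$ be the weak$^*$ topology on it obtained by pairing with the space $C_b(X)$ of bounded continuous real functions. A plan is a finite positive $\tau_b$-Borel measure $\boldsymbol\eta$ on $\mathcal M^+(X)$; put $\boldsymbol\eta^{\#}(E)=\int_{\mathcal M^+(X)}\mu(E)\,d\boldsymbol\eta(\mu)$ for Borel $E\subset X$, and let $\boldsymbol\eta^*$ be the outer measure induced by $\boldsymbol\eta$. For an arbitrary $\mathcal E\subset\mathcal M^+(X)$ define the $1$-plan content $$\operatorname{Ct}(\mathcal E)=\sup\bigl\{\boldsymbol\eta^*(\mathcal E):\ \boldsymbol\eta\text{ is a plan},\ \boldsymbol\eta^{\#}\ll\boldsymbol m,\ \|d\boldsymbol\eta^{\#}/d\boldsymbol m\|_{L^\infty(\boldsymbol m)}\le 1\bigr\}\in[0,\infty].$$ A closed linear subspace $A$ of $C_b(X)$ is called acceptable if it is a sublattice and if for every closed $F\subset X$ and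 every $x\in X\setminus F$ there is $g\in A$ with $0\le g\le 1$, $g(x)=1$ and $g|_F=0$; let $\tau_A$ be the weak$^*$ topology on $\mathcal M^+(X)$ obtained by pairing with $A$. Then $(\mathcal M^+(X),\tau_b)$ is a Polish space and $\operatorname{Ct}$ is a Choquet capacity on it. Moreover, for every acceptable $A$ the topology $\tau_A$ is Hausdorff and $\operatorname{Ct}$ satisfies on $(\mathcal M^+(X),\tau_A)$ the following three conditions (which, for $\tau_b$, are the ones that define a Choquet capacity on a Polish space): (i) $\operatorname{Ct}(\mathcal E)\le\operatorname{Ct}(\mathcal F)$ whenever $\mathcal E\subset\mathcal F\subset\mathcal M^+(X)$; (ii) $\operatorname{Ct}\bigl(\bigcup_j\mathcal E_j\bigr)=\lim_j\operatorname{Ct}(\mathcal E_j)$ for every increasing sequence $\mathcal E_1\subset\mathcal E_2\subset\cdots$ of arbitrary subsets of $\mathcal M^+(X)$; (iii) $\operatorname{Ct}\bigl(\bigcap_j\mathcal K_j\bigr)=\lim_j\operatorname{Ct}(\mathcal K_j)$ for every decreasing sequence $\mathcal K_1\supset\mathcal K_2\supset\cdots$ of $\tau_A$-compact subsets of $\mathcal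 M^+(X)$. -/

import Mathlib

open MeasureTheory Filter Topology Set
open scoped ENNReal NNReal BoundedContinuousFunction

noncomputable section

namespace PlanContent

/-! ### Choquet capacities -/

/-- Monotonicity, continuity along increasing sequences of arbitrary sets, and continuity along
decreasing sequences of compact sets, for a set function on a topological space `Y`. -/
structure CapacityConditions {Y : Type*} [TopologicalSpace Y] (cap : Set Y → ℝ≥0∞) : Prop where
  mono : ∀ E F : Set Y, E ⊆ F → cap E ≤ cap F
  upward : ∀ E : ℕ → Set Y, Monotone E →
    Tendsto (fun j => cap (E j)) atTop (𝓝 (cap (⋃ j, E j)))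
  downward : ∀ K : ℕ → Set Y, (∀ j, IsCompact (K j)) → Antitone K →
    Tendsto (fun j => cap (K j)) atTop (𝓝 (cap (⋂ j, K j)))

/-- A Choquet capacity: the three capacity conditions hold and the space is Polish. -/
structure IsChoquetCapacity {Y : Type*} [TopologicalSpace Y] (cap : Set Y → ℝ≥0∞) : Prop
    extends CapacityConditions cap where
  polish : PolishSpace Y

/-! ### Acceptable subspaces and their topologies on the cone of finite measures -/

/-- A closed linear subspace of the bounded continuous functions which is a sublattice and
separates points from closed sets. -/
structure IsAcceptable {X : Type*} [TopologicalSpace X] (A : Submodule ℝ (X →ᵇ ℝ)) : Prop where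
  isClosed : IsClosed (A : Set (X →ᵇ ℝ))
  sup_mem : ∀ f ∈ A, ∀ g ∈ A, f ⊔ g ∈ A
  inf_mem : ∀ f ∈ A, ∀ g ∈ A, f ⊓ g ∈ A
  separates : ∀ F : Set X, IsClosed F → ∀ x ∉ F,
    ∃ g ∈ A, (∀ y, 0 ≤ g y ∧ g y ≤ 1) ∧ g x = 1 ∧ ∀ y ∈ F, g y = 0

/-- The topology `τ_A` on the positive finite measures: the weak* topology obtained by pairing with
the functions in `A`, i.e. the weakest one making `μ ↦ ∫ g dμ` continuous for all `g ∈ A`.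
The topology `τ_b` (`A` the space of all bounded continuous functions) is Mathlib's topology on
`FiniteMeasure X`. -/
@[reducible]
def tauA {X : Type*} [TopologicalSpace X] [MeasurableSpace X] (A : Submodule ℝ (X →ᵇ ℝ)) :
    TopologicalSpace (FiniteMeasure X) :=
  TopologicalSpace.induced
    (fun (μ : FiniteMeasure X) (g : A) => ∫ x, (g : X →ᵇ ℝ) x ∂(μ : Measure X))
    Pi.topologicalSpace

/-! ### Plans and their content -/

/-- Measures on the `τ_b`-Borel sets of the cone of finite measures. The σ-algebra is given
explicitly. A plan is a finite such measure. -/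
abbrev BorelMeasureOnMeasures (X : Type*) [TopologicalSpace X] [MeasurableSpace X]
    [OpensMeasurableSpace X] : Type _ :=
  @Measure (FiniteMeasure X) (borel (FiniteMeasure X))

/-- For Borel `E ⊆ X` the evaluation `μ ↦ μ E` is Borel. -/
theorem measurable_toMeasure {X : Type*} [TopologicalSpace X] [PolishSpace X]
    [MeasurableSpace X] [BorelSpace X] :
    @Measurable (FiniteMeasure X) (Measure X) (borel (FiniteMeasure X)) _
      (fun μ => (μ : Measure X)) := by
  let : MeasurableSpace (FiniteMeasure X) := borel (FiniteMeasure X)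
  have : BorelSpace (FiniteMeasure X) := ⟨rfl⟩
  have key : ∀ f : X →ᵇ ℝ≥0, Measurable fun μ : FiniteMeasure X => ∫⁻ x, f x ∂(μ : Measure X) :=
    fun f => (FiniteMeasure.continuous_lintegral_boundedContinuousFunction f).measurable
  have hclosed : ∀ F : Set X, IsClosed F →
      Measurable fun μ : FiniteMeasure X => (μ : Measure X) F := by
    intro F hF
    refine measurable_of_tendsto_metrizable (f := fun n (μ : FiniteMeasure X) =>
      ∫⁻ x, hF.apprSeq n x ∂(μ : Measure X)) (fun n => key _) ?_
    rw [tendsto_pi_nhds]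
    intro μ
    exact HasOuterApproxClosed.tendsto_lintegral_apprSeq hF (μ : Measure X)
  refine Measurable.measure_of_isPiSystem (S := {F : Set X | IsClosed F}) ?_ ?_ ?_ ?_
  · rw [‹BorelSpace X›.measurable_eq, borel_eq_generateFrom_isClosed]
  · exact isPiSystem_isClosed
  · exact fun F hF => hclosed F hF
  · exact hclosed univ isClosed_univ

/-- The barycenter `η^#(E) = ∫ μ(E) dη(μ)`, as a Borel measure on `X`. -/
def barycenter {X : Type*} [TopologicalSpace X] [MeasurableSpace X] [OpensMeasurableSpace X]
    (η : BorelMeasureOnMeasures X) : Measure X :=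
  @Measure.bind (FiniteMeasure X) X (borel (FiniteMeasure X)) _ η (fun μ => (μ : Measure X))

/-- The defining formula of the barycenter. -/
theorem barycenter_apply {X : Type*} [TopologicalSpace X] [PolishSpace X] [MeasurableSpace X]
    [BorelSpace X] (η : BorelMeasureOnMeasures X) {E : Set X} (hE : MeasurableSet E) :
    barycenter η E =
      @lintegral (FiniteMeasure X) (borel (FiniteMeasure X)) η (fun μ => (μ : Measure X) E) :=
  @Measure.bind_apply (FiniteMeasure X) X (borel (FiniteMeasure X)) _ η _ E hE
    (@Measurable.aemeasurable _ _ (borel (FiniteMeasure X)) _ _ η measurable_toMeasure)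

/-- `η` is a plan whose barycenter is absolutely continuous with respect to `m`, with a density
of `L^∞(m)`-norm at most one. -/
structure IsCompetitor {X : Type*} [TopologicalSpace X] [MeasurableSpace X]
    [OpensMeasurableSpace X] (m : Measure X) (η : BorelMeasureOnMeasures X) : Prop where
  finite : IsFiniteMeasure η
  absolutelyContinuous : barycenter η ≪ m
  density_bound : ∃ g : X → ℝ≥0∞, Measurable g ∧ barycenter η = m.withDensity g ∧
    eLpNorm g ∞ m ≤ 1

/-- The `1`-plan content `Ct` of an arbitrary family of finite measures. In Mathlib the value of a
measure on an arbitrary set is the infimum of its values on measurable supersets, so `η E` is the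
value of the induced outer measure `η^*`. -/
def Ct {X : Type*} [TopologicalSpace X] [MeasurableSpace X] [OpensMeasurableSpace X]
    (m : Measure X) (E : Set (FiniteMeasure X)) : ℝ≥0∞ :=
  ⨆ (η : BorelMeasureOnMeasures X) (_ : IsCompetitor m η), η E

end PlanContent

end

/-!
The content `Ct` is a capacity for a reason of compactness. Monotonicity is clear, and continuity
along increasing sequences holds because it holds for every outer measure induced by a measure, and
suprema commute. The work lies in decreasing sequences of compact sets and in the Polish property.

Everything is seen through a *determining sequence* `d` (`IsDetermining`): countably many functions
in the given acceptable subspace, directed under suprema, which approximate the indicator of every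
open set from below. It exists because `X` is second countable
(`IsAcceptable.exists_isDetermining`). By monotone convergence the integrals `∫ d n ∂μ` recover `μ`
on open sets, so that `μ ↦ (∫ d n ∂μ)_n` is a continuous injection of the finite measures into
`ℕ → ℝ`, for `τ_b` and for `τ_A`. This gives the Hausdorff property of `τ_A`.

For `τ_A`-compact `K j` decreasing and competitors `η j` with `c ≤ η j (K j)`, restrict `η j` to
`K j`, scale it to mass `c`, and push it forward to `ℕ → ℝ`. The images of the `K j` are compact, so
there is a weak limit; it has mass `c`, it is concentrated on the image of `⋂ j, K j`, and it is
pulled back to a plan by the Lusin–Souslin theorem (`exists_limit_measure_of_injective`). A plan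
is a competitor if and only if its barycenter lies below `m` (`isCompetitor_iff`), and by outer
regularity of `m` this says `∫ ∫ d n ∂μ ∂η ≤ ∫ d n ∂m` for all `n` (`IsDetermining.barycenter_le_iff`),
a condition that persists in the limit. Outer regularity and σ-finiteness of `m` come from local
finiteness, which a measure that is inner regular and finite on compact sets enjoys on a first
countable space (`isLocallyFiniteMeasure_of_innerRegular`).

The Polish property (`polishSpace_finiteMeasure`) follows from a closed embedding into a countable
product of Polish spaces, whose properness is Prokhorov's theorem.
-/

namespace PlanContent

/-! ### Determining sequences -/

section

variable {X : Type*} [TopologicalSpace X]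

/-- A sequence of continuous functions `X → [0, 1]`, upwards directed, which approximates the
indicator of every open set from below. Such a sequence determines finite measures and controls
measures of open sets. -/
structure IsDetermining (d : ℕ → X →ᵇ ℝ) : Prop where
  nonneg : ∀ n x, 0 ≤ d n x
  le_one : ∀ n x, d n x ≤ 1
  exists_sup : ∀ m n, ∃ k, d k = d m ⊔ d n
  approx : ∀ U : Set X, IsOpen U → ∀ x ∈ U, ∀ ε : ℝ, 0 < ε →
    ∃ n, 1 - ε < d n x ∧ ∀ y ∉ U, d n y = 0

/-- Second countability of `X` reduces the separation property of an acceptable subspace to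
countably many of its functions; closing these up under finite suprema makes them directed. -/
theorem IsAcceptable.exists_isDetermining [SecondCountableTopology X]
    {A : Submodule ℝ (X →ᵇ ℝ)} (hA : IsAcceptable A) :
    ∃ d : ℕ → X →ᵇ ℝ, (∀ n, d n ∈ A) ∧ IsDetermining d := by
  have hsep : ∀ (B : Set X) (x : X), ∃ g ∈ A, (∀ y, 0 ≤ g y ∧ g y ≤ 1) ∧
      (IsOpen B → x ∈ B → g x = 1 ∧ ∀ y ∉ B, g y = 0) := by
    intro B x
    by_cases h : IsOpen B ∧ x ∈ B
    · obtain ⟨g, hg, h01, h1, h0⟩ := hA.separates Bᶜ h.1.isClosed_compl x (by simpa using h.2)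
      exact ⟨g, hg, h01, fun _ _ => ⟨h1, h0⟩⟩
    · exact ⟨0, A.zero_mem, by simp, fun h1 h2 => absurd ⟨h1, h2⟩ h⟩
  choose g hgA hg01 hg using hsep
  have hcov : ∀ (B : Set X) (k : ℕ), ∃ T : Set X, T ⊆ B ∧ T.Countable ∧
      ⋃ x ∈ T, {y | 1 - 1 / ((k : ℝ) + 1) < g B x y} =
        ⋃ x ∈ B, {y | 1 - 1 / ((k : ℝ) + 1) < g B x y} := fun B k =>
    TopologicalSpace.isOpen_biUnion_countable B _
      fun x _ => isOpen_lt continuous_const (g B x).continuous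
  choose T hTB hTc hT using hcov
  let S : Set (X →ᵇ ℝ) := insert 0
    (⋃ B ∈ TopologicalSpace.countableBasis X, ⋃ k : ℕ, g B '' T B k)
  have hS : S.Countable := by
    refine Set.Countable.insert _ ?_
    exact (TopologicalSpace.countable_countableBasis X).biUnion
      fun B _ => countable_iUnion fun k => (hTc B k).image _
  obtain ⟨s, hs⟩ := hS.exists_eq_range (insert_nonempty _ _)
  have hsS : ∀ n, s n ∈ A ∧ ∀ y, 0 ≤ s n y ∧ s n y ≤ 1 := by
    intro n
    have : s n ∈ S := hs ▸ mem_range_self n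
    rcases this with h | h
    · rw [h]; exact ⟨A.zero_mem, by simp⟩
    · simp only [mem_iUnion] at h
      obtain ⟨B, -, k, x, -, h⟩ := h
      rw [← h]
      exact ⟨hgA _ _, hg01 _ _⟩
  let D : List ℕ → X →ᵇ ℝ := fun l => l.foldr (fun a f => s a ⊔ f) 0
  have hDcons : ∀ a l, D (a :: l) = s a ⊔ D l := fun a l => rfl
  have hD : ∀ l, D l ∈ A ∧ ∀ y, 0 ≤ D l y ∧ D l y ≤ 1 := by
    intro l
    induction l with
    | nil => exact ⟨A.zero_mem, by simp [D]⟩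
    | cons a l ih =>
      rw [hDcons]
      refine ⟨hA.sup_mem _ (hsS a).1 _ ih.1, fun y => ?_⟩
      rw [BoundedContinuousFunction.coe_sup, Pi.sup_apply]
      exact ⟨le_sup_of_le_left ((hsS a).2 y).1, sup_le ((hsS a).2 y).2 (ih.2 y).2⟩
  have happ : ∀ l l', D (l ++ l') = D l ⊔ D l' := by
    intro l l'
    induction l with
    | nil =>
      have : (0 : X →ᵇ ℝ) ≤ D l' := fun y => ((hD l').2 y).1
      exact (sup_eq_right.2 this).symm
    | cons a l ih => rw [List.cons_append, hDcons, hDcons, ih, sup_assoc]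
  obtain ⟨e, he⟩ := exists_surjective_nat (List ℕ)
  refine ⟨fun n => D (e n), fun n => (hD _).1, fun n x => ((hD _).2 x).1,
    fun n x => ((hD _).2 x).2, fun m n => ?_, fun U hU x hx ε hε => ?_⟩
  · obtain ⟨k, hk⟩ := he (e m ++ e n)
    exact ⟨k, by rw [hk, happ]⟩
  · obtain ⟨B, hB, hxB, hBU⟩ :=
      (TopologicalSpace.isBasis_countableBasis X).exists_subset_of_mem_open hx hU
    have hBo := (TopologicalSpace.isBasis_countableBasis X).isOpen hB
    obtain ⟨k, hk⟩ := exists_nat_one_div_lt hε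
    have hx' : x ∈ ⋃ x ∈ T B k, {y | 1 - 1 / ((k : ℝ) + 1) < g B x y} := by
      rw [hT]
      refine mem_biUnion hxB ?_
      rw [mem_ofPred_eq, (hg B x hBo hxB).1]
      linarith [Nat.one_div_pos_of_nat (α := ℝ) (n := k)]
    simp only [mem_iUnion] at hx'
    obtain ⟨z, hz, hzx⟩ := hx'
    have hmem : g B z ∈ S := by
      refine Or.inr ?_
      simp only [mem_iUnion]
      exact ⟨B, hB, k, z, hz, rfl⟩
    rw [hs] at hmem
    obtain ⟨n, hn⟩ := hmem
    obtain ⟨j, hj⟩ := he [n]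
    have hDj : D (e j) = g B z := by
      rw [hj, hDcons, hn]
      exact sup_eq_left.2 fun y => (hg01 B z y).1
    refine ⟨j, ?_, fun y hy => ?_⟩
    · rw [mem_ofPred_eq] at hzx
      simp only [hDj]
      linarith
    · simp only [hDj]
      exact (hg B z hBo (hTB _ _ hz)).2 y fun h => hy (hBU h)

theorem isAcceptable_top [NormalSpace X] [T1Space X] :
    IsAcceptable (⊤ : Submodule ℝ (X →ᵇ ℝ)) where
  isClosed := isClosed_univ
  sup_mem _ _ _ _ := trivial
  inf_mem _ _ _ _ := trivial
  separates F hF x hx := by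
    obtain ⟨f, h0, h1, h⟩ := exists_bounded_zero_one_of_closed hF (isClosed_singleton (x := x))
      (disjoint_singleton_right.2 hx)
    exact ⟨f, trivial, h, h1 rfl, fun y hy => h0 hy⟩

/-! ### Measures seen through a determining sequence -/

namespace IsDetermining

variable [MeasurableSpace X] [BorelSpace X] {d : ℕ → X →ᵇ ℝ}

theorem measure_isOpen_eq_iSup (hd : IsDetermining d) (μ : Measure X) {U : Set X}
    (hU : IsOpen U) :
    μ U = ⨆ n : {n // ∀ y ∉ U, d n y = 0}, ∫⁻ x, ENNReal.ofReal (d n x) ∂μ := by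
  rw [← lintegral_iSup_directed_of_measurable
    (f := fun (n : {n // ∀ y ∉ U, d n y = 0}) x => ENNReal.ofReal (d n x))
    (fun n => (d n).continuous.measurable.ennreal_ofReal), ← lintegral_indicator_one hU.measurableSet]
  · congr 1
    ext x
    by_cases hx : x ∈ U
    · rw [indicator_of_mem hx]
      refine le_antisymm ?_ (iSup_le fun n => ENNReal.ofReal_le_one.2 (hd.le_one _ _))
      refine le_of_forall_lt fun c hc => ?_
      have hc' : c ≠ ∞ := (hc.trans ENNReal.one_lt_top).ne
      have hc1 : c.toReal < 1 := by
        simpa using (ENNReal.toReal_lt_toReal hc' ENNReal.one_ne_top).2 hc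
      obtain ⟨n, hn, hn0⟩ := hd.approx U hU x hx (1 - c.toReal) (by linarith)
      refine lt_of_lt_of_le ?_ (le_iSup (fun n : {n // ∀ y ∉ U, d n y = 0} =>
        ENNReal.ofReal (d n x)) ⟨n, hn0⟩)
      rw [ENNReal.lt_ofReal_iff_toReal_lt hc']
      linarith
    · rw [indicator_of_notMem hx]
      symm
      simp only [ENNReal.iSup_eq_zero, ENNReal.ofReal_eq_zero]
      exact fun n => (n.2 x hx).le
  · rintro ⟨m, hm⟩ ⟨n, hn⟩
    obtain ⟨k, hk⟩ := hd.exists_sup m n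
    refine ⟨⟨k, fun y hy => ?_⟩, fun x => ?_, fun x => ?_⟩
    · simp [hk, hm y hy, hn y hy]
    · exact ENNReal.ofReal_le_ofReal (by simp [hk])
    · exact ENNReal.ofReal_le_ofReal (by simp [hk])

theorem ofReal_integral (hd : IsDetermining d) (μ : FiniteMeasure X) (n : ℕ) :
    ENNReal.ofReal (∫ x, d n x ∂(μ : Measure X)) =
      ∫⁻ x, ENNReal.ofReal (d n x) ∂(μ : Measure X) :=
  ofReal_integral_eq_lintegral_ofReal ((d n).integrable _) (ae_of_all _ (hd.nonneg n))

/-- Finite measures are determined by their integrals against a determining sequence. -/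
theorem injective_integral (hd : IsDetermining d) :
    Function.Injective fun (μ : FiniteMeasure X) (n : ℕ) => ∫ x, d n x ∂(μ : Measure X) := by
  intro μ ν h
  have hopen : ∀ U : Set X, IsOpen U → (μ : Measure X) U = (ν : Measure X) U := by
    intro U hU
    rw [hd.measure_isOpen_eq_iSup _ hU, hd.measure_isOpen_eq_iSup _ hU]
    refine iSup_congr fun n => ?_
    rw [← hd.ofReal_integral, ← hd.ofReal_integral]
    exact congrArg ENNReal.ofReal (congrFun h n)
  refine FiniteMeasure.toMeasure_injective ?_
  exact ext_of_generate_finite {U | IsOpen U}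
    (BorelSpace.measurable_eq.trans rfl) isPiSystem_isOpen
    (fun U hU => hopen U hU) (hopen _ isOpen_univ)

end IsDetermining

theorem continuous_tauA_integral [MeasurableSpace X] {A : Submodule ℝ (X →ᵇ ℝ)} {g : X →ᵇ ℝ}
    (hg : g ∈ A) :
    @Continuous _ _ (tauA A) _ fun μ : FiniteMeasure X => ∫ x, g x ∂(μ : Measure X) := by
  let : TopologicalSpace (FiniteMeasure X) := tauA A
  have h : Continuous fun (μ : FiniteMeasure X) (g : A) =>
      ∫ x, (g : X →ᵇ ℝ) x ∂(μ : Measure X) := continuous_induced_dom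
  exact continuous_pi_iff.1 h ⟨g, hg⟩

theorem IsAcceptable.t2Space_tauA [SecondCountableTopology X] [MeasurableSpace X] [BorelSpace X]
    {A : Submodule ℝ (X →ᵇ ℝ)} (hA : IsAcceptable A) :
    @T2Space (FiniteMeasure X) (tauA A) := by
  obtain ⟨d, hdA, hd⟩ := hA.exists_isDetermining
  let : TopologicalSpace (FiniteMeasure X) := tauA A
  exact T2Space.of_injective_continuous hd.injective_integral
    (continuous_pi fun n => continuous_tauA_integral (hdA n))

end

/-! ### The space of finite measures on a Polish space is Polish -/

/-- Dini's theorem in the form of a continuous map into `C(ℕ∞, ℝ)`: continuous functions decreasing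
pointwise to zero, together with their limit at `⊤`, are jointly continuous. -/
theorem continuous_uncurry_of_antitone {Z : Type*} [TopologicalSpace Z] {a : Z → ℕ → ℝ}
    (hc : ∀ n, Continuous fun z => a z n) (ha : ∀ z, Antitone (a z))
    (h0 : ∀ z n, 0 ≤ a z n) (hlim : ∀ z, Tendsto (a z) atTop (𝓝 0)) :
    Continuous fun p : Z × ℕ∞ => if p.2 = ⊤ then 0 else a p.1 p.2.toNat := by
  rw [continuous_iff_continuousAt]
  rintro ⟨z, n⟩
  by_cases hn : n = ⊤
  · subst hn
    rw [ContinuousAt, if_pos rfl, Metric.tendsto_nhds]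
    intro ε hε
    obtain ⟨N, hN⟩ := ((hlim z).eventually_lt_const hε).exists
    have h1 : ∀ᶠ w in 𝓝 z, a w N < ε := ((hc N).tendsto z).eventually_lt_const hN
    have h2 : ∀ᶠ m : ℕ∞ in 𝓝 ⊤, (N : ℕ∞) < m := lt_mem_nhds (ENat.natCast_lt_top N)
    rw [nhds_prod_eq]
    filter_upwards [h1.prod_mk h2] with p hp
    split_ifs with h
    · simpa using hε
    · rw [Real.dist_0_eq_abs, abs_of_nonneg (h0 _ _)]
      refine (ha _ ?_).trans_lt hp.1
      have := hp.2
      rw [← ENat.natCast_toNat h, Nat.cast_lt] at this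
      exact this.le
  · have h2 : {p : Z × ℕ∞ | p.2 = n} ∈ 𝓝 (z, n) := by
      rw [nhds_prod_eq, ENat.nhds_eq_pure hn]
      exact mem_of_superset (prod_mem_prod univ_mem (mem_pure.2 (mem_singleton n)))
        fun p hp => hp.2
    refine ContinuousAt.congr (f := fun p : Z × ℕ∞ => a p.1 n.toNat)
      ((hc _).comp continuous_fst).continuousAt ?_
    filter_upwards [h2] with p hp
    have hp' : p.2 = n := hp
    simp only [hp', if_neg hn]

section

variable {X : Type*} [MetricSpace X]

/-- A cutoff function vanishing on the first `N + 1` points of a sequence `x` and equal to one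
at distance at least `1 / (k + 1)` from them. -/
noncomputable def cutoff (x : ℕ → X) (k N : ℕ) : X →ᵇ ℝ :=
  BoundedContinuousFunction.mkOfBound
    ⟨fun y => min 1 ((k + 1) * Metric.infDist y (x '' Iic N)),
      continuous_const.min (continuous_const.mul (Metric.continuous_infDist_pt _))⟩ 1
    fun y z => by
      have h : ∀ y, min 1 ((k + 1) * Metric.infDist y (x '' Iic N)) ∈ Icc (0 : ℝ) 1 := fun y =>
        ⟨le_min zero_le_one (mul_nonneg (by positivity) Metric.infDist_nonneg), min_le_left _ _⟩
      exact Real.dist_le_of_mem_Icc_01 (h y) (h z)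

theorem cutoff_apply (x : ℕ → X) (k N : ℕ) (y : X) :
    cutoff x k N y = min 1 ((k + 1) * Metric.infDist y (x '' Iic N)) := rfl

theorem cutoff_nonneg (x : ℕ → X) (k N : ℕ) (y : X) : 0 ≤ cutoff x k N y :=
  le_min zero_le_one (mul_nonneg (by positivity) Metric.infDist_nonneg)

theorem cutoff_antitone (x : ℕ → X) (k : ℕ) (y : X) : Antitone fun N => cutoff x k N y := by
  intro M N h
  refine min_le_min le_rfl (mul_le_mul_of_nonneg_left ?_ (by positivity))
  exact Metric.infDist_le_infDist_of_subset (image_mono (Iic_subset_Iic.2 h)) (nonempty_Iic.image x)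

theorem tendsto_cutoff {x : ℕ → X} (hx : DenseRange x) (k : ℕ) (y : X) :
    Tendsto (fun N => cutoff x k N y) atTop (𝓝 0) := by
  rw [Metric.tendsto_atTop]
  intro c hc
  have hk : (0 : ℝ) < (k : ℝ) + 1 := by positivity
  obtain ⟨n, hn⟩ := hx.exists_dist_lt y (div_pos hc hk)
  refine ⟨n, fun N hN => ?_⟩
  rw [Real.dist_0_eq_abs, abs_of_nonneg (cutoff_nonneg x k N y), cutoff_apply]
  refine (min_le_right _ _).trans_lt ?_
  rw [mul_comm, ← lt_div_iff₀ hk]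
  exact (Metric.infDist_le_dist_of_mem (mem_image_of_mem x (mem_Iic.2 hN))).trans_lt hn

/-- In a complete space, a set lying for every `k` within `1 / (k + 1)` of finitely many points of
a sequence is relatively compact. -/
theorem isCompact_infDist_le [CompleteSpace X] (x : ℕ → X) (N : ℕ → ℕ) :
    IsCompact {y | ∀ k : ℕ, (k + 1) * Metric.infDist y (x '' Iic (N k)) ≤ 1} := by
  refine TotallyBounded.isCompact_of_isClosed ?_ ?_
  · refine Metric.totallyBounded_iff.2 fun ε hε => ?_
    obtain ⟨k, hk⟩ := exists_nat_one_div_lt hε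
    refine ⟨x '' Iic (N k), (finite_Iic _).image _, fun y hy => ?_⟩
    have h : Metric.infDist y (x '' Iic (N k)) < ε := by
      refine lt_of_le_of_lt ?_ hk
      rw [le_div_iff₀ (by positivity), mul_comm]
      exact hy k
    obtain ⟨z, hz, hyz⟩ := (Metric.infDist_lt_iff (nonempty_Iic.image x)).1 h
    exact mem_biUnion hz hyz
  · simp only [ofPred_forall]
    exact isClosed_iInter fun k =>
      isClosed_le (continuous_const.mul (Metric.continuous_infDist_pt _)) continuous_const

variable [MeasurableSpace X] [BorelSpace X]

theorem tendsto_integral_cutoff {x : ℕ → X} (hx : DenseRange x) (k : ℕ) (μ : FiniteMeasure X) :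
    Tendsto (fun N => ∫ y, cutoff x k N y ∂(μ : Measure X)) atTop (𝓝 0) := by
  rw [← integral_zero X ℝ (μ := (μ : Measure X))]
  refine tendsto_integral_of_dominated_convergence (fun _ => (1 : ℝ))
    (fun N => (cutoff x k N).continuous.aestronglyMeasurable) (integrable_const _)
    (fun N => ae_of_all _ fun y => ?_) (ae_of_all _ fun y => tendsto_cutoff hx k y)
  rw [Real.norm_of_nonneg (cutoff_nonneg _ _ _ _)]
  exact min_le_left _ _

theorem antitone_integral_cutoff (x : ℕ → X) (k : ℕ) (μ : FiniteMeasure X) :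
    Antitone fun N => ∫ y, cutoff x k N y ∂(μ : Measure X) := fun _ _ h =>
  integral_mono ((cutoff x k _).integrable _) ((cutoff x k _).integrable _)
    fun y => cutoff_antitone x k y h

theorem measure_le_integral_cutoff (x : ℕ → X) (k N : ℕ) (μ : FiniteMeasure X) :
    (μ : Measure X) {y | 1 < (k + 1) * Metric.infDist y (x '' Iic N)} ≤
      ENNReal.ofReal (∫ y, cutoff x k N y ∂(μ : Measure X)) := by
  rw [ofReal_integral_eq_lintegral_ofReal ((cutoff x k N).integrable _)
    (ae_of_all _ (cutoff_nonneg x k N))]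
  refine le_trans (measure_mono fun y hy => ?_) ((mul_meas_ge_le_lintegral
    (cutoff x k N).continuous.measurable.ennreal_ofReal 1).trans' (one_mul _).ge)
  rw [mem_ofPred_eq] at hy ⊢
  rw [cutoff_apply, min_eq_left hy.le, ENNReal.ofReal_one]

/-- The integrals of the cutoff functions, as a continuous function on `ℕ∞` for each `k`. -/
noncomputable def cutoffProfile {x : ℕ → X} (hx : DenseRange x) (k : ℕ) :
    C(FiniteMeasure X, C(ℕ∞, ℝ)) :=
  ContinuousMap.curry ⟨_, continuous_uncurry_of_antitone
    (a := fun (μ : FiniteMeasure X) N => ∫ y, cutoff x k N y ∂(μ : Measure X))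
    (fun N => FiniteMeasure.continuous_integral_boundedContinuousFunction (cutoff x k N))
    (antitone_integral_cutoff x k)
    (fun _ _ => integral_nonneg (cutoff_nonneg x k _)) (tendsto_integral_cutoff hx k)⟩

theorem cutoffProfile_top {x : ℕ → X} (hx : DenseRange x) (k : ℕ) (μ : FiniteMeasure X) :
    cutoffProfile hx k μ ⊤ = 0 := by
  rw [cutoffProfile, ContinuousMap.curry_apply]
  simp

theorem cutoffProfile_natCast {x : ℕ → X} (hx : DenseRange x) (k : ℕ) (μ : FiniteMeasure X)
    (N : ℕ) : cutoffProfile hx k μ N = ∫ y, cutoff x k N y ∂(μ : Measure X) := by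
  rw [cutoffProfile, ContinuousMap.curry_apply]
  simp

/-- On a compact set of functions on `ℕ∞` vanishing at `⊤`, the decay at `⊤` is uniform. -/
theorem _root_.IsCompact.exists_nat_forall_lt {C : Set C(ℕ∞, ℝ)} (hC : IsCompact C) {ε : ℝ}
    (hε : 0 < ε) : ∃ N : ℕ, ∀ f ∈ C, f ⊤ = 0 → f N < ε := by
  have hopen : IsOpen {p : C(ℕ∞, ℝ) × ℕ∞ | p.1 p.2 - p.1 ⊤ < ε} :=
    isOpen_lt (by fun_prop) continuous_const
  obtain ⟨u, v, -, hv, hu, htv, huv⟩ := generalized_tube_lemma hC (isCompact_singleton (x := ⊤))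
    hopen (by rintro ⟨f, n⟩ ⟨-, rfl⟩; simpa using hε)
  have := ENat.tendsto_natCast_nhds_top.eventually (hv.mem_nhds (htv rfl))
  obtain ⟨N, hN⟩ := this.exists
  refine ⟨N, fun f hf hf0 => ?_⟩
  have := huv (mk_mem_prod (hu hf) hN)
  simpa [hf0] using this

end

/-- The finite measures on a Polish space form a Polish space. A measure is sent to its mass, its
integrals against a determining sequence, and the profiles which measure how fast it is exhausted
by finite unions of small balls. On the preimage of a compact set the masses are bounded and the
profiles decay uniformly, so that the preimage is tight, and compact by Prokhorov's theorem. Hence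
the map is proper and injective, that is, a closed embedding into a Polish space. -/
theorem polishSpace_finiteMeasure (X : Type*) [TopologicalSpace X] [PolishSpace X]
    [MeasurableSpace X] [BorelSpace X] : PolishSpace (FiniteMeasure X) := by
  rcases isEmpty_or_nonempty X with hX | hX
  · have : Subsingleton (FiniteMeasure X) := ⟨fun μ ν => by
      refine FiniteMeasure.toMeasure_injective ?_
      rw [Measure.eq_zero_of_isEmpty (μ : Measure X), Measure.eq_zero_of_isEmpty (ν : Measure X)]⟩
    exact (IsClosedEmbedding.of_continuous_injective_isClosedMap (f := fun _ : FiniteMeasure X => ())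
      continuous_const (Function.injective_of_subsingleton _)
      fun s _ => (finite_univ.subset (subset_univ _)).isClosed).polishSpace
  let := TopologicalSpace.upgradeIsCompletelyMetrizable X
  obtain ⟨d, -, hd⟩ := (isAcceptable_top (X := X)).exists_isDetermining
  have hx := TopologicalSpace.denseRange_denseSeq X
  set x := TopologicalSpace.denseSeq X
  let G : FiniteMeasure X → ℝ≥0 × (ℕ → ℝ) × (ℕ → C(ℕ∞, ℝ)) := fun μ =>
    (μ.mass, fun n => ∫ y, d n y ∂(μ : Measure X), fun k => cutoffProfile hx k μ)
  have hGc : Continuous G := by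
    refine FiniteMeasure.continuous_mass.prodMk (Continuous.prodMk ?_ ?_)
    · exact continuous_pi fun n =>
        FiniteMeasure.continuous_integral_boundedContinuousFunction (d n)
    · exact continuous_pi fun k => (cutoffProfile hx k).continuous
  have hGi : Function.Injective G := fun μ ν h =>
    hd.injective_integral (congrArg (fun p => p.2.1) h)
  have hGp : IsProperMap G := by
    refine isProperMap_iff_isCompact_preimage.2 ⟨hGc, fun C hC => ?_⟩
    obtain ⟨M, hM⟩ := (hC.image continuous_fst).bddAbove
    obtain ⟨ε, hε0, hεs⟩ := ENNReal.exists_pos_sum_of_countable (one_ne_zero) ℕ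
    have hN : ∀ n k : ℕ, ∃ N : ℕ, ∀ μ ∈ G ⁻¹' C,
        ∫ y, cutoff x k N y ∂(μ : Measure X) < ε k / (n + 1) := by
      intro n k
      have hCk : IsCompact ((fun p : ℝ≥0 × (ℕ → ℝ) × (ℕ → C(ℕ∞, ℝ)) => p.2.2 k) '' C) :=
        hC.image (by fun_prop)
      obtain ⟨N, hN⟩ := hCk.exists_nat_forall_lt (ε := ε k / (n + 1))
        (div_pos (NNReal.coe_pos.2 (hε0 k)) (by positivity))
      refine ⟨N, fun μ hμ => ?_⟩
      rw [← cutoffProfile_natCast hx]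
      exact hN _ ⟨G μ, hμ, rfl⟩ (cutoffProfile_top hx k μ)
    choose N hN using hN
    have key := isCompact_setOfPred_finiteMeasure_mass_le_compl_isCompact_le (E := X) M
      (u := fun n => 1 / ((n : ℝ≥0) + 1)) tendsto_one_div_add_atTop_nhds_zero_nat
      (fun n => isCompact_infDist_le x (N n)) (Or.inl inferInstance)
    refine key.of_isClosed_subset (hC.isClosed.preimage hGc) fun μ hμ =>
      ⟨hM (mem_image_of_mem Prod.fst hμ), fun n => ?_⟩
    rw [← ENNReal.coe_le_coe, FiniteMeasure.ennreal_coeFn_eq_coeFn_toMeasure]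
    have hsub : {y | ∀ k : ℕ, (k + 1) * Metric.infDist y (x '' Iic (N n k)) ≤ 1}ᶜ ⊆
        ⋃ k : ℕ, {y | 1 < (k + 1) * Metric.infDist y (x '' Iic (N n k))} := by
      intro y hy
      simpa using hy
    have hle : ∀ k, (μ : Measure X) {y | 1 < (k + 1) * Metric.infDist y (x '' Iic (N n k))} ≤
        ε k * ((1 / ((n : ℝ≥0) + 1) : ℝ≥0) : ℝ≥0∞) := by
      intro k
      refine (measure_le_integral_cutoff x k _ μ).trans ?_
      rw [← ENNReal.coe_mul, mul_one_div, ← ENNReal.ofReal_coe_nnreal]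
      refine ENNReal.ofReal_le_ofReal ?_
      push_cast
      exact (hN n k μ hμ).le
    calc (μ : Measure X) _ ≤ (μ : Measure X) _ := measure_mono hsub
      _ ≤ ∑' k, _ := measure_iUnion_le _
      _ ≤ ∑' k, ε k * ((1 / ((n : ℝ≥0) + 1) : ℝ≥0) : ℝ≥0∞) := ENNReal.tsum_le_tsum hle
      _ ≤ 1 * ((1 / ((n : ℝ≥0) + 1) : ℝ≥0) : ℝ≥0∞) := by
        rw [ENNReal.tsum_mul_right]
        gcongr
      _ = _ := one_mul _
  exact (IsClosedEmbedding.of_continuous_injective_isClosedMap hGc hGi hGp.isClosedMap).polishSpace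

/-! ### Limits of measures concentrated on a decreasing sequence of compact sets -/

/-- Compactness of the measures concentrated on a compact subset of `ℕ → ℝ`: measures of mass `c`,
the `j`-th one concentrated on `C j`, accumulate at a measure of mass `c` concentrated on
`⋂ j, C j`, and bounds on the integrals of the positive parts of the coordinates persist. -/
theorem exists_limit_measure {C : ℕ → Set (ℕ → ℝ)} (hC : ∀ j, IsCompact (C j)) (hanti : Antitone C)
    (c : ℝ≥0) (ν : ℕ → FiniteMeasure (ℕ → ℝ)) (hmass : ∀ j, (ν j).mass = c)
    (hν : ∀ j, (ν j : Measure (ℕ → ℝ)) (C j)ᶜ = 0) (b : ℕ → ℝ≥0∞)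
    (hb : ∀ j n, ∫⁻ y, ENNReal.ofReal (y n) ∂(ν j : Measure (ℕ → ℝ)) ≤ b n) :
    ∃ ν' : FiniteMeasure (ℕ → ℝ), ν'.mass = c ∧ (ν' : Measure (ℕ → ℝ)) (⋂ j, C j)ᶜ = 0 ∧
      ∀ n, ∫⁻ y, ENNReal.ofReal (y n) ∂(ν' : Measure (ℕ → ℝ)) ≤ b n := by
  have hle : ((hyperfilter ℕ : Ultrafilter ℕ) : Filter ℕ) ≤ atTop :=
    hyperfilter_le_cofinite.trans Nat.cofinite_eq_atTop.le
  obtain ⟨ν', -, hν'⟩ := (isCompact_setOfPred_finiteMeasure_le_of_isCompact c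
    (hC 0)).ultrafilter_le_nhds ((hyperfilter ℕ).map ν) (by
      refine le_principal_iff.2 (Ultrafilter.mem_map.2 (Filter.Eventually.of_forall fun j => ?_))
      refine ⟨(hmass j).le, ?_⟩
      rw [FiniteMeasure.null_iff_toMeasure_null]
      exact measure_mono_null (compl_subset_compl.2 (hanti (Nat.zero_le j))) (hν j))
  have hlim : Tendsto ν (hyperfilter ℕ : Ultrafilter ℕ) (𝓝 ν') := hν'
  have hmass' : ν'.mass = c :=
    tendsto_nhds_unique hlim.mass (tendsto_const_nhds.congr fun j => (hmass j).symm)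
  have hconc : ∀ j, (ν' : Measure (ℕ → ℝ)) (C j)ᶜ = 0 := by
    intro j
    have h1 : (c : ℝ≥0∞) ≤ (ν' : Measure (ℕ → ℝ)) (C j) := by
      refine le_trans ?_ (FiniteMeasure.limsup_measure_closed_le_of_tendsto hlim (hC j).isClosed)
      refine le_limsup_of_frequently_le (Eventually.frequently ?_)
      filter_upwards [hle (eventually_ge_atTop j)] with i hi
      rw [← hmass i, FiniteMeasure.ennreal_mass,
        ← measure_add_measure_compl (hC i).measurableSet, hν i, add_zero]
      exact measure_mono (hanti hi)
    rw [measure_compl (hC j).measurableSet (measure_ne_top _ _), ← FiniteMeasure.ennreal_mass,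
      hmass', tsub_eq_zero_of_le h1]
  refine ⟨ν', hmass', ?_, fun n => ?_⟩
  · rw [compl_iInter]
    exact measure_iUnion_null hconc
  · -- The coordinates are unbounded on `ℕ → ℝ`, so they are truncated at their bound on `C 0`.
    obtain ⟨M, hM⟩ := ((hC 0).image (continuous_apply n)).bddAbove
    let f : (ℕ → ℝ) →ᵇ ℝ≥0 := BoundedContinuousFunction.mkOfBound
      ⟨fun y => min (y n).toNNReal M.toNNReal, by fun_prop⟩ M.toNNReal fun y z => by
        rw [NNReal.dist_eq]
        exact abs_sub_le_of_nonneg_of_le (NNReal.coe_nonneg _)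
          (NNReal.coe_le_coe.2 (min_le_right (y n).toNNReal _)) (NNReal.coe_nonneg _)
          (NNReal.coe_le_coe.2 (min_le_right (z n).toNNReal _))
    have hf : ∀ y, (f y : ℝ≥0∞) ≤ ENNReal.ofReal (y n) := fun y =>
      ENNReal.coe_le_coe.2 (min_le_left (y n).toNNReal _)
    have h1 : ∫⁻ y, ENNReal.ofReal (y n) ∂(ν' : Measure (ℕ → ℝ)) =
        ∫⁻ y, f y ∂(ν' : Measure (ℕ → ℝ)) := by
      refine lintegral_congr_ae ?_
      filter_upwards [mem_ae_iff.2 (hconc 0)] with y hy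
      refine congrArg ENNReal.ofNNReal (min_eq_left (a := (y n).toNNReal) ?_).symm
      exact Real.toNNReal_le_toNNReal (hM (mem_image_of_mem (fun y : ℕ → ℝ => y n) hy))
    rw [h1]
    exact le_of_tendsto (FiniteMeasure.tendsto_iff_forall_lintegral_tendsto.1 hlim f)
      (Eventually.of_forall fun j => (lintegral_mono hf).trans (hb j n))

/-- The version of `exists_limit_measure` on a Polish space embedded into `ℕ → ℝ` by a continuous
injection. The limit measure is pulled back, which the Lusin–Souslin theorem allows. -/
theorem exists_limit_measure_of_injective {Z : Type*} [TopologicalSpace Z] [PolishSpace Z]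
    [MeasurableSpace Z] [BorelSpace Z] {Φ : Z → ℕ → ℝ} (hΦ : Continuous Φ)
    (hinj : Function.Injective Φ) {K : ℕ → Set Z} (hK : ∀ j, IsCompact (Φ '' K j))
    (hanti : Antitone K) (c : ℝ≥0) (η : ℕ → Measure Z) [∀ j, IsFiniteMeasure (η j)]
    (hc : ∀ j, c ≤ η j (K j)) (b : ℕ → ℝ≥0∞)
    (hb : ∀ j n, ∫⁻ z, ENNReal.ofReal (Φ z n) ∂(η j) ≤ b n) :
    ∃ η' : Measure Z, IsFiniteMeasure η' ∧ c ≤ η' (⋂ j, K j) ∧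
      ∀ n, ∫⁻ z, ENNReal.ofReal (Φ z n) ∂η' ≤ b n := by
  have hemb : MeasurableEmbedding Φ := hΦ.measurableEmbedding hinj
  have hKm : ∀ j, MeasurableSet (K j) := fun j => by
    rw [← preimage_image_eq (K j) hinj]
    exact hemb.measurable (hK j).measurableSet
  -- Restrict `η j` to `K j` and scale it down to mass `c`.
  let t : ℕ → ℝ≥0 := fun j => c / (η j (K j)).toNNReal
  have ht1 : ∀ j, t j ≤ 1 := fun j => div_le_one_of_le₀
    (by rw [← ENNReal.coe_le_coe, ENNReal.coe_toNNReal (measure_ne_top _ _)]; exact hc j)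
    zero_le
  have htc : ∀ j, t j * η j (K j) = c := by
    intro j
    rw [← ENNReal.coe_toNNReal (measure_ne_top (η j) (K j)), ← ENNReal.coe_mul]
    rcases eq_or_ne (η j (K j)).toNNReal 0 with h | h
    · have h' : (c : ℝ≥0∞) ≤ ((η j (K j)).toNNReal : ℝ≥0) := by
        rw [ENNReal.coe_toNNReal (measure_ne_top _ _)]
        exact hc j
      rw [h] at h' ⊢
      rw [mul_zero]
      exact le_antisymm (by simp) h'
    · rw [div_mul_cancel₀ _ h]
  let ν : ℕ → Measure (ℕ → ℝ) := fun j => t j • ((η j).restrict (K j)).map Φ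
  have hνf : ∀ j, IsFiniteMeasure (ν j) := fun j => by
    have := Measure.isFiniteMeasure_map ((η j).restrict (K j)) Φ
    infer_instance
  have hνapp : ∀ j s, ν j s = t j * η j (Φ ⁻¹' s ∩ K j) := by
    intro j s
    rw [Measure.smul_apply, hemb.map_apply, Measure.restrict_apply' (hKm j)]
    rfl
  let νF : ℕ → FiniteMeasure (ℕ → ℝ) := fun j => ⟨ν j, hνf j⟩
  have hνF : ∀ j, (νF j : Measure (ℕ → ℝ)) = ν j := fun j => rfl
  obtain ⟨ν', hmass, hconc, hint⟩ := exists_limit_measure hK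
    (fun i j h => image_mono (hanti h)) c νF
    (fun j => by
      rw [← ENNReal.coe_inj, FiniteMeasure.ennreal_mass, hνF, hνapp,
        preimage_univ, univ_inter, htc])
    (fun j => by
      rw [hνF, hνapp, preimage_compl, preimage_image_eq _ hinj]
      simp) b
    (fun j n => by
      rw [hνF, lintegral_smul_measure, hemb.lintegral_map]
      refine le_trans ?_ (hb j n)
      calc (t j : ℝ≥0∞) * ∫⁻ z in K j, ENNReal.ofReal (Φ z n) ∂(η j)
          ≤ 1 * ∫⁻ z in K j, ENNReal.ofReal (Φ z n) ∂(η j) :=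
            mul_le_mul_left (ENNReal.coe_le_one_iff.2 (ht1 j)) _
        _ = ∫⁻ z in K j, ENNReal.ofReal (Φ z n) ∂(η j) := one_mul _
        _ ≤ _ := setLIntegral_le_lintegral _ _)
  rw [← hinj.injOn.image_iInter_eq] at hconc
  have hmap : ((ν' : Measure (ℕ → ℝ)).comap Φ).map Φ = ν' := by
    rw [hemb.map_comap, Measure.restrict_eq_self_of_ae_mem]
    exact mem_ae_iff.2 (measure_mono_null (compl_subset_compl.2 (image_subset_range _ _)) hconc)
  refine ⟨(ν' : Measure (ℕ → ℝ)).comap Φ, inferInstance, ?_, fun n => ?_⟩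
  · rw [hemb.comap_apply, ← hmass, FiniteMeasure.ennreal_mass]
    have hm : MeasurableSet (Φ '' ⋂ j, K j) :=
      hemb.measurableSet_image' (MeasurableSet.iInter hKm)
    rw [← measure_add_measure_compl hm, hconc, add_zero]
  · have h := hint n
    rwa [← hmap, hemb.lintegral_map] at h

/-! ### Barycenters and the reference measure -/

section

variable {X : Type*} [TopologicalSpace X] [MeasurableSpace X]

/-- If every neighbourhood of `x` had infinite measure, compact sets of measure at least `n`
shrinking to `x` would, together with `x`, form a compact set of infinite measure. -/
theorem isLocallyFiniteMeasure_of_innerRegular [FirstCountableTopology X]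
    [OpensMeasurableSpace X] (m : Measure X) [IsFiniteMeasureOnCompacts m] [m.InnerRegular] :
    IsLocallyFiniteMeasure m := by
  refine ⟨fun x => ?_⟩
  by_contra h
  have hinf : ∀ U : Set X, x ∈ U → IsOpen U → m U = ∞ := by
    intro U hx hU
    by_contra hne
    exact h ⟨U, hU.mem_nhds hx, lt_top_iff_ne_top.2 hne⟩
  obtain ⟨U, hU⟩ := (nhds_basis_opens x).exists_antitone_subbasis
  have hex : ∀ n : ℕ, ∃ C ⊆ U n, IsCompact C ∧ (n : ℝ≥0∞) < m C := fun n =>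
    (hU.1 n).2.measurableSet.exists_lt_isCompact
      (by rw [hinf _ (hU.1 n).1 (hU.1 n).2]; exact ENNReal.natCast_lt_top n)
  choose C hCU hC hCm using hex
  have hcomp : IsCompact (insert x (⋃ n, C n)) := by
    refine isCompact_iff_ultrafilter_le_nhds.2 fun f hf => ?_
    by_cases hfx : (f : Filter X) ≤ 𝓝 x
    · exact ⟨x, mem_insert _ _, hfx⟩
    -- An ultrafilter which does not converge to `x` avoids some `U N`, and lives on finitely many
    -- of the sets `C n`.
    obtain ⟨N, hN⟩ : ∃ N, U N ∉ (f : Filter X) := by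
      by_contra! hcon
      exact hfx (hU.2.ge_iff.2 fun n _ => hcon n)
    have hNc : (U N)ᶜ ∈ f := Ultrafilter.compl_mem_iff_notMem.2 hN
    have hfin : IsCompact (⋃ n ∈ Iio N, C n) := (finite_Iio N).isCompact_biUnion fun n _ => hC n
    have hmem : (⋃ n ∈ Iio N, C n) ∈ f := by
      refine mem_of_superset (inter_mem (le_principal_iff.1 hf) hNc) ?_
      rintro y ⟨rfl | hy, hyN⟩
      · exact absurd (mem_of_mem_nhds (hU.2.mem_of_mem trivial)) hyN
      · obtain ⟨n, hn⟩ := mem_iUnion.1 hy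
        refine mem_biUnion (mem_Iio.2 ?_) hn
        by_contra! hle
        exact hyN (hU.2.antitone hle (hCU n hn))
    obtain ⟨y, hy, hfy⟩ := hfin.ultrafilter_le_nhds f (le_principal_iff.2 hmem)
    exact ⟨y, mem_insert_of_mem _ (iUnion₂_subset (fun n _ => subset_iUnion C n) hy), hfy⟩
  refine (hcomp.measure_lt_top (μ := m)).ne (ENNReal.eq_top_of_forall_nnreal_le fun r => ?_)
  obtain ⟨n, hn⟩ := exists_nat_ge r
  calc (r : ℝ≥0∞) ≤ (n : ℝ≥0∞) := by exact_mod_cast hn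
    _ ≤ m (C n) := (hCm n).le
    _ ≤ m _ := measure_mono ((subset_iUnion C n).trans (subset_insert _ _))

theorem isCompetitor_iff [OpensMeasurableSpace X] {m : Measure X} [SigmaFinite m]
    {η : BorelMeasureOnMeasures X} :
    IsCompetitor m η ↔ IsFiniteMeasure η ∧ barycenter η ≤ m := by
  refine ⟨fun h => ⟨h.finite, ?_⟩, fun h => ⟨h.1, Measure.absolutelyContinuous_of_le h.2, ?_⟩⟩
  · obtain ⟨g, -, hg, hg1⟩ := h.density_bound
    rw [hg]
    refine (withDensity_mono (μ := m) (g := 1) ?_).trans_eq withDensity_one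
    filter_upwards [ae_le_eLpNormEssSup (f := g) (μ := m)] with x hx
    rw [eLpNorm_exponent_top] at hg1
    exact hx.trans hg1
  · have hfin : SigmaFinite (barycenter η) := Measure.sigmaFinite_of_le m h.2
    refine ⟨(barycenter η).rnDeriv m, Measure.measurable_rnDeriv _ _,
      (Measure.withDensity_rnDeriv_eq _ _ (Measure.absolutelyContinuous_of_le h.2)).symm, ?_⟩
    rw [eLpNorm_exponent_top]
    exact eLpNormEssSup_le_of_ae_enorm_bound (Measure.rnDeriv_le_one_of_le h.2)

theorem lintegral_barycenter [PolishSpace X] [BorelSpace X] (η : BorelMeasureOnMeasures X)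
    {f : X → ℝ≥0∞} (hf : Measurable f) :
    ∫⁻ x, f x ∂(barycenter η) =
      @lintegral (FiniteMeasure X) (borel (FiniteMeasure X)) η
        fun μ => ∫⁻ x, f x ∂(μ : Measure X) := by
  let : MeasurableSpace (FiniteMeasure X) := borel (FiniteMeasure X)
  exact Measure.lintegral_bind measurable_toMeasure.aemeasurable hf.aemeasurable

theorem IsDetermining.barycenter_le_iff [PolishSpace X] [BorelSpace X] {d : ℕ → X →ᵇ ℝ}
    (hd : IsDetermining d) {m : Measure X} [m.OuterRegular] {η : BorelMeasureOnMeasures X} :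
    barycenter η ≤ m ↔ ∀ n, @lintegral (FiniteMeasure X) (borel (FiniteMeasure X)) η
      (fun μ => ENNReal.ofReal (∫ x, d n x ∂(μ : Measure X))) ≤
        ∫⁻ x, ENNReal.ofReal (d n x) ∂m := by
  have key : ∀ n, @lintegral (FiniteMeasure X) (borel (FiniteMeasure X)) η
      (fun μ => ENNReal.ofReal (∫ x, d n x ∂(μ : Measure X))) =
        ∫⁻ x, ENNReal.ofReal (d n x) ∂(barycenter η) := fun n => by
    simp_rw [hd.ofReal_integral]
    exact (lintegral_barycenter η (d n).continuous.measurable.ennreal_ofReal).symm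
  simp_rw [key]
  refine ⟨fun h n => lintegral_mono' h le_rfl, fun h => Measure.le_iff.2 fun s _ => ?_⟩
  rw [s.measure_eq_iInf_isOpen m]
  refine le_iInf₂ fun U hsU => le_iInf fun hU => (measure_mono hsU).trans ?_
  rw [hd.measure_isOpen_eq_iSup _ hU, hd.measure_isOpen_eq_iSup _ hU]
  exact iSup_mono fun n => h n

end

/-! ### The capacity conditions -/

section

variable {X : Type*} [TopologicalSpace X] [MeasurableSpace X]

theorem Ct_mono [OpensMeasurableSpace X] (m : Measure X) {E F : Set (FiniteMeasure X)}
    (h : E ⊆ F) : Ct m E ≤ Ct m F :=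
  iSup₂_mono fun _ _ => measure_mono h

/-- Outer measures induced by measures are continuous along increasing sequences of arbitrary
sets, and suprema commute. -/
theorem Ct_iUnion [OpensMeasurableSpace X] (m : Measure X) {E : ℕ → Set (FiniteMeasure X)}
    (h : Monotone E) : Ct m (⋃ j, E j) = ⨆ j, Ct m (E j) := by
  simp only [Ct, h.measure_iUnion]
  exact (iSup_congr fun η => iSup_comm).trans iSup_comm

theorem Ct_iInter [PolishSpace X] [BorelSpace X] (m : Measure X) [SigmaFinite m] [m.OuterRegular]
    {d : ℕ → X →ᵇ ℝ} (hd : IsDetermining d) {K : ℕ → Set (FiniteMeasure X)}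
    (hK : ∀ j, IsCompact
      ((fun (μ : FiniteMeasure X) n => ∫ x, d n x ∂(μ : Measure X)) '' K j))
    (hanti : Antitone K) : Ct m (⋂ j, K j) = ⨅ j, Ct m (K j) := by
  refine le_antisymm (le_iInf fun j => Ct_mono m (iInter_subset K j))
    (ENNReal.le_of_forall_nnreal_lt fun c hc => ?_)
  have hex : ∀ j, ∃ η : BorelMeasureOnMeasures X, IsCompetitor m η ∧ c ≤ η (K j) := by
    intro j
    have h := hc.trans_le (iInf_le _ j)
    simp only [Ct, lt_iSup_iff] at h
    obtain ⟨η, hη, h⟩ := h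
    exact ⟨η, hη, h.le⟩
  choose η hη hc using hex
  have := polishSpace_finiteMeasure X
  let : MeasurableSpace (FiniteMeasure X) := borel (FiniteMeasure X)
  have : BorelSpace (FiniteMeasure X) := ⟨rfl⟩
  have : ∀ j, IsFiniteMeasure (η j) := fun j => (hη j).finite
  obtain ⟨η', hfin, hle, hint⟩ := exists_limit_measure_of_injective
    (continuous_pi fun n => FiniteMeasure.continuous_integral_boundedContinuousFunction (d n))
    hd.injective_integral hK hanti c η hc (fun n => ∫⁻ x, ENNReal.ofReal (d n x) ∂m)
    (fun j n => hd.barycenter_le_iff.1 (isCompetitor_iff.1 (hη j)).2 n)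
  exact hle.trans (le_iSup₂_of_le η'
    (isCompetitor_iff.2 ⟨hfin, hd.barycenter_le_iff.2 hint⟩) le_rfl)

/-- The capacity conditions hold for every topology for which the integrals against some
determining sequence are continuous. -/
theorem capacityConditions_Ct [PolishSpace X] [BorelSpace X] (m : Measure X)
    [IsFiniteMeasureOnCompacts m] [m.InnerRegular] {d : ℕ → X →ᵇ ℝ} (hd : IsDetermining d)
    (τ : TopologicalSpace (FiniteMeasure X))
    (hτ : ∀ n, @Continuous _ _ τ _ fun μ : FiniteMeasure X => ∫ x, d n x ∂(μ : Measure X)) :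
    @CapacityConditions (FiniteMeasure X) τ (Ct m) := by
  have := isLocallyFiniteMeasure_of_innerRegular m
  refine @CapacityConditions.mk _ τ _ (fun _ _ h => Ct_mono m h) (fun E hE => ?_)
    fun K hK hanti => ?_
  · rw [Ct_iUnion m hE]
    exact tendsto_atTop_iSup fun i j h => Ct_mono m (hE h)
  · rw [Ct_iInter m hd (fun j => @IsCompact.image _ _ τ _ _ _ (hK j)
      (@continuous_pi _ _ _ τ _ _ hτ)) hanti]
    exact tendsto_atTop_iInf fun i j h => Ct_mono m (hanti h)

end

end PlanContent

theorem theoremt {X : Type*} [TopologicalSpace X] [PolishSpace X] [MeasurableSpace X]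
    [BorelSpace X] (m : Measure X) [IsFiniteMeasureOnCompacts m] [m.InnerRegular] :
    PlanContent.IsChoquetCapacity (Y := FiniteMeasure X) (PlanContent.Ct m) ∧
    ∀ A : Submodule ℝ (X →ᵇ ℝ), PlanContent.IsAcceptable A →
      @T2Space (FiniteMeasure X) (PlanContent.tauA A) ∧
      @PlanContent.CapacityConditions (FiniteMeasure X) (PlanContent.tauA A)
        (PlanContent.Ct m) := by
  refine ⟨?_, fun A hA => ⟨hA.t2Space_tauA, ?_⟩⟩
  · obtain ⟨d, -, hd⟩ := (PlanContent.isAcceptable_top (X := X)).exists_isDetermining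
    exact ⟨PlanContent.capacityConditions_Ct m hd _ fun n =>
      FiniteMeasure.continuous_integral_boundedContinuousFunction (d n),
      PlanContent.polishSpace_finiteMeasure X⟩
  · obtain ⟨d, hdA, hd⟩ := hA.exists_isDetermining
    exact PlanContent.capacityConditions_Ct m hd _ fun n =>
      PlanContent.continuous_tauA_integral (hdA n)
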